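/- Conventions. Composition of 1-cells is written in diagrammatic order. A \emph{monad} $m$ in a bicategory $\mathcal B$ is an object $x$ with a 1-cell $t : x \to x$ and 2-cells $\eta : \mathrm{id}_x \Rightarrow t$, $\mu : t\cdot t \Rightarrow t$ satisfying the unit and associativity laws. A morphism of monads $(x,t)\to(x',t')$ is a 1-cell $f : x \to x'$ with a 2-cell $\theta : f\cdot t' \Rightarrow t\cdot f$ compatible with units and multiplications, and a 2-cell $(f,\theta)\Rightarrow(g,\theta')$ is a 2-cell $f\Rightarrow g$ commuting with $\theta,\theta'$; these form categories $\mathrm{Mnd}(\mathcal B)(m,m')$. An \emph{Eilenberg–Moore cone} for $m$ is an object $e$ with a monad morphism from the identity monad $\mathrm{id}_e$ on $e$ to $m$; it is \emph{universal} if for every object $z$ the functor $\mathcal B(z,e)\to \mathrm{Mnd}(\mathcal B)(\mathrm{id}_z,m)$ given by composition with the cone is an equivalence of categories. $\mathcal B$ \emph{has Eilenberg–Moore objects} if a universal cone $\mathcal B^m$ is given for every monad $m$. A 1-cell is an \emph{adjoint equivalence} if it has a right adjoint with invertible unit and counit. For an adjunction $l\dashv r$ with $l : x\to y$, unit $\eta$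 and counit $\varepsilon$, let $m$ be the induced monad on $x$ with underlying 1-cell $l\cdot r$; the 1-cell $r$ with the 2-cell $r\cdot(l\cdot r)\cong (r\cdot l)\cdot r\Rightarrow \mathrm{id}_y\cdot r$ induced by $\varepsilon$ is an Eilenberg–Moore cone on $y$ for $m$, and the 1-cell $y\to\mathcal B^{m}$ induced by it is the \emph{comparison 1-cell}. In a bicategory with Eilenberg–Moore objects, the adjunction is \emph{monadic} if its comparison 1-cell is an adjoint equivalence. For every object $w$, composition with $l$ and $r$ gives an adjunction $\mathcal B(w,l)\dashv\mathcal B(w,r)$ between the categories $\mathcal B(w,x)$ and $\mathcal B(w,y)$. A category is \emph{univalent} if for all objects $a,b$ the canonical map from equalities $a=b$ to isomorphisms $a\cong b$ is bijective; $\mathcal B$ is \emph{locally univalent} if all its hom-categories are univalent. $\mathbf{Cat}$ is the bicategory of categories, functors and natural transformations, and $\mathbf{UnivCat}$ its full sub-bicategory on the univalent categories; both have Eilenberg–Moore objects, given by the usual categories of algebras with their forgetful functors. (Sizes: the 2-cells of $\mathcal B$ between two given 1-cells are no larger than the hom-categories of $\mathcal B$, so that the category of algebras of a monad on a hom-category has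 again the size of a hom-category.) Theorem. Let $\mathcal B$ be a bicategory with Eilenberg–Moore objects, and let $l\dashv r$ be an adjunction in $\mathcal B$ with $l : x\to y$. (a) The adjunction $l\dashv r$ is monadic if and only if for every object $w$ of $\mathcal B$ the adjunction $\mathcal B(w,l)\dashv\mathcal B(w,r)$ is a monadic adjunction in $\mathbf{Cat}$. (b) If $\mathcal B$ is locally univalent, then $l\dashv r$ is monadic if and only if it is representably monadic, that is, for every object $w$ of $\mathcal B$ the adjunction $\mathcal B(w,l)\dashv\mathcal B(w,r)$ is a monadic adjunction in $\mathbf{UnivCat}$. -/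

import Mathlib

open CategoryTheory
open scoped CategoryTheory.Bicategory

universe w v u

namespace FormalMonads

section Monads

variable {B : Type u} [Bicategory.{w, v} B]

/-- A monad in a bicategory `B`. -/
structure BicatMonad (B : Type u) [Bicategory.{w, v} B] where
  obj : B
  endo : obj ⟶ obj
  unit : 𝟙 obj ⟶ endo
  mult : endo ≫ endo ⟶ endo
  right_unit : (ρ_ endo).inv ≫ endo ◁ unit ≫ mult = 𝟙 endo
  left_unit : (λ_ endo).inv ≫ unit ▷ endo ≫ mult = 𝟙 endo
  assoc : endo ◁ mult ≫ mult = (α_ endo endo endo).inv ≫ mult ▷ endo ≫ mult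

/-- A 1-cell `m₁ ⟶ m₂` in the bicategory of monads in `B`. -/
@[ext]
structure MonadHom (m₁ m₂ : BicatMonad B) where
  mor : m₁.obj ⟶ m₂.obj
  cell : mor ≫ m₂.endo ⟶ m₁.endo ≫ mor
  unit_cell : (ρ_ mor).inv ≫ mor ◁ m₂.unit ≫ cell = (λ_ mor).inv ≫ m₁.unit ▷ mor
  mult_cell : mor ◁ m₂.mult ≫ cell =
    (α_ mor m₂.endo m₂.endo).inv ≫ cell ▷ m₂.endo ≫ (α_ m₁.endo mor m₂.endo).hom ≫
      m₁.endo ◁ cell ≫ (α_ m₁.endo m₁.endo mor).inv ≫ m₁.mult ▷ mor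

/-- A 2-cell between 1-cells of monads. -/
@[ext]
structure MonadHom₂ {m₁ m₂ : BicatMonad B} (f g : MonadHom m₁ m₂) where
  cell : f.mor ⟶ g.mor
  comm : f.cell ≫ m₁.endo ◁ cell = cell ▷ m₂.endo ≫ g.cell

/-- The hom-category from `m₁` to `m₂` of the bicategory of monads in `B`. -/
instance monadHomCategory (m₁ m₂ : BicatMonad B) : Category (MonadHom m₁ m₂) where
  Hom f g := MonadHom₂ f g
  id f := { cell := 𝟙 f.mor, comm := by simp }
  comp a b :=
    { cell := a.cell ≫ b.cell
      comm := by
        rw [Bicategory.whiskerLeft_comp, reassoc_of% a.comm, b.comm, Bicategory.comp_whiskerRight,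
          Category.assoc] }
  id_comp a := by apply MonadHom₂.ext; simp
  comp_id a := by apply MonadHom₂.ext; simp
  assoc a b c := by apply MonadHom₂.ext; simp

@[simp]
theorem monadHom_id_cell {m₁ m₂ : BicatMonad B} (f : MonadHom m₁ m₂) :
    MonadHom₂.cell (𝟙 f) = 𝟙 f.mor := rfl

@[simp]
theorem monadHom_comp_cell {m₁ m₂ : BicatMonad B} {f g h : MonadHom m₁ m₂} (a : f ⟶ g)
    (b : g ⟶ h) : MonadHom₂.cell (a ≫ b) = MonadHom₂.cell a ≫ MonadHom₂.cell b := rfl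

/-- The identity monad on `x`. -/
@[simps]
def idMonad (x : B) : BicatMonad B where
  obj := x
  endo := 𝟙 x
  unit := 𝟙 (𝟙 x)
  mult := (λ_ (𝟙 x)).hom
  right_unit := by simp [Bicategory.unitors_equal]
  left_unit := by simp
  assoc := by simp [Bicategory.unitors_equal]

theorem homFunctor_unit {x e a : B} (f : x ⟶ e) (u : e ⟶ a) (t : a ⟶ a) (η : 𝟙 a ⟶ t)
    (c : u ≫ t ⟶ 𝟙 e ≫ u) (h : (ρ_ u).inv ≫ u ◁ η ≫ c = (λ_ u).inv ≫ 𝟙 (𝟙 e) ▷ u) :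
    (ρ_ (f ≫ u)).inv ≫ (f ≫ u) ◁ η ≫ (α_ f u t).hom ≫ f ◁ c ≫ f ◁ (λ_ u).hom ≫
      (λ_ (f ≫ u)).inv = (λ_ (f ≫ u)).inv ≫ 𝟙 (𝟙 x) ▷ (f ≫ u) := by
  calc
    _ = f ◁ ((ρ_ u).inv ≫ u ◁ η ≫ c) ≫ f ◁ (λ_ u).hom ≫ (λ_ (f ≫ u)).inv := by
      bicategory
    _ = _ := by rw [h]; simp

theorem homFunctor_mult {x e a : B} (f : x ⟶ e) (u : e ⟶ a) (t : a ⟶ a) (μ : t ≫ t ⟶ t)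
    (c : u ≫ t ⟶ 𝟙 e ≫ u)
    (h : u ◁ μ ≫ c = (α_ u t t).inv ≫ c ▷ t ≫ (α_ (𝟙 e) u t).hom ≫ 𝟙 e ◁ c ≫
      (α_ (𝟙 e) (𝟙 e) u).inv ≫ (λ_ (𝟙 e)).hom ▷ u) :
    (f ≫ u) ◁ μ ≫ (α_ f u t).hom ≫ f ◁ c ≫ f ◁ (λ_ u).hom ≫ (λ_ (f ≫ u)).inv =
      (α_ (f ≫ u) t t).inv ≫
        ((α_ f u t).hom ≫ f ◁ c ≫ f ◁ (λ_ u).hom ≫ (λ_ (f ≫ u)).inv) ▷ t ≫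
        (α_ (𝟙 x) (f ≫ u) t).hom ≫
        𝟙 x ◁ ((α_ f u t).hom ≫ f ◁ c ≫ f ◁ (λ_ u).hom ≫ (λ_ (f ≫ u)).inv) ≫
        (α_ (𝟙 x) (𝟙 x) (f ≫ u)).inv ≫ (λ_ (𝟙 x)).hom ▷ (f ≫ u) := by
  calc
    _ = (α_ _ _ _).hom ≫ f ◁ (u ◁ μ ≫ c) ≫ f ◁ (λ_ u).hom ≫ (λ_ (f ≫ u)).inv := by
      bicategory
    _ = _ := by rw [h]; bicategory

theorem homFunctor_comm {x e a : B} {f g : x ⟶ e} (u : e ⟶ a) (t : a ⟶ a)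
    (c : u ≫ t ⟶ 𝟙 e ≫ u) (τ : f ⟶ g) :
    ((α_ f u t).hom ≫ f ◁ c ≫ f ◁ (λ_ u).hom ≫ (λ_ (f ≫ u)).inv) ≫ 𝟙 x ◁ (τ ▷ u) =
      (τ ▷ u) ▷ t ≫ (α_ g u t).hom ≫ g ◁ c ≫ g ◁ (λ_ u).hom ≫ (λ_ (g ≫ u)).inv := by
  calc
    _ = (α_ f u t).hom ≫ f ◁ (c ≫ (λ_ u).hom) ≫ τ ▷ u ≫ (λ_ (g ≫ u)).inv := by
      bicategory
    _ = (α_ f u t).hom ≫ τ ▷ (u ≫ t) ≫ g ◁ (c ≫ (λ_ u).hom) ≫ (λ_ (g ≫ u)).inv := by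
      rw [Bicategory.whisker_exchange_assoc]
    _ = _ := by bicategory

/-- An Eilenberg–Moore cone for the monad `m`: an object with a 1-cell of monads from its identity
monad to `m`. -/
structure EMCone (m : BicatMonad B) where
  obj : B
  hom : MonadHom (idMonad obj) m

namespace EMCone

variable {m : BicatMonad B} (e : EMCone m)

/-- The functor from the hom-category `x ⟶ e` to the hom-category of 1-cells from the identity
monad on `x` to `m`, given by composition with the cone `e`. -/
@[simps]
def homFunctor (x : B) : (x ⟶ e.obj) ⥤ MonadHom (idMonad x) m where
  obj f :=
    { mor := f ≫ e.hom.mor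
      cell := (α_ f e.hom.mor m.endo).hom ≫ f ◁ e.hom.cell ≫ f ◁ (λ_ e.hom.mor).hom ≫
        (λ_ (f ≫ e.hom.mor)).inv
      unit_cell := homFunctor_unit f _ _ _ _ e.hom.unit_cell
      mult_cell := homFunctor_mult f _ _ _ _ e.hom.mult_cell }
  map τ :=
    { cell := τ ▷ e.hom.mor
      comm := homFunctor_comm _ _ _ τ }
  map_id _ := MonadHom₂.ext (Bicategory.id_whiskerRight _ _)
  map_comp _ _ := MonadHom₂.ext (Bicategory.comp_whiskerRight _ _ _)

/-- An Eilenberg–Moore cone is universal if composition with it is an equivalence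
on all hom-categories. -/
def IsUniversal : Prop := ∀ x : B, (e.homFunctor x).IsEquivalence

end EMCone

/-- `B` has Eilenberg–Moore objects: a choice of a universal cone for every monad. -/
structure EMObjects (B : Type u) [Bicategory.{w, v} B] where
  cone : ∀ m : BicatMonad B, EMCone m
  isUniversal : ∀ m, (cone m).IsUniversal

/-- The 1-cell into the Eilenberg–Moore object of `m` induced by a cone `q` for `m`, determined
up to invertible 2-cell by the universal property. -/
noncomputable def EMObjects.lift (E : EMObjects B) {m : BicatMonad B} (q : EMCone m) :
    q.obj ⟶ (E.cone m).obj :=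
  haveI := E.isUniversal m q.obj
  ((E.cone m).homFunctor q.obj).objPreimage q.hom

section AdjunctionLaws
variable {x y : B} {l : x ⟶ y} {r : y ⟶ x} (adj : Bicategory.Adjunction l r)
open Bicategory

theorem adjMonad_right_unit :
    (ρ_ (l ≫ r)).inv ≫ (l ≫ r) ◁ adj.unit ≫ (α_ l r (l ≫ r)).hom ≫ l ◁ (α_ r l r).inv ≫
      l ◁ (adj.counit ▷ r) ≫ l ◁ (λ_ r).hom = 𝟙 (l ≫ r) := by
  calc
    _ = 𝟙 _ ⊗≫ l ◁ rightZigzag adj.unit adj.counit ⊗≫ 𝟙 _ := by bicategory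
    _ = _ := by rw [adj.right_triangle]; bicategory

theorem adjMonad_left_unit :
    (λ_ (l ≫ r)).inv ≫ adj.unit ▷ (l ≫ r) ≫ (α_ l r (l ≫ r)).hom ≫ l ◁ (α_ r l r).inv ≫
      l ◁ (adj.counit ▷ r) ≫ l ◁ (λ_ r).hom = 𝟙 (l ≫ r) := by
  calc
    _ = 𝟙 _ ⊗≫ leftZigzag adj.unit adj.counit ▷ r ⊗≫ 𝟙 _ := by bicategory
    _ = _ := by rw [adj.left_triangle]; bicategory

theorem adjMonad_assoc :
    (l ≫ r) ◁ ((α_ l r (l ≫ r)).hom ≫ l ◁ (α_ r l r).inv ≫ l ◁ (adj.counit ▷ r) ≫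
        l ◁ (λ_ r).hom) ≫ (α_ l r (l ≫ r)).hom ≫ l ◁ (α_ r l r).inv ≫ l ◁ (adj.counit ▷ r) ≫
        l ◁ (λ_ r).hom =
      (α_ (l ≫ r) (l ≫ r) (l ≫ r)).inv ≫ ((α_ l r (l ≫ r)).hom ≫ l ◁ (α_ r l r).inv ≫
        l ◁ (adj.counit ▷ r) ≫ l ◁ (λ_ r).hom) ▷ (l ≫ r) ≫ (α_ l r (l ≫ r)).hom ≫
        l ◁ (α_ r l r).inv ≫ l ◁ (adj.counit ▷ r) ≫ l ◁ (λ_ r).hom := by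
  calc
    _ = 𝟙 _ ⊗≫ l ◁ ((r ≫ l) ◁ adj.counit ≫ adj.counit ▷ 𝟙 y) ▷ r ⊗≫ 𝟙 _ := by bicategory
    _ = _ := by rw [whisker_exchange]; bicategory

theorem adjCone_unit :
    (ρ_ r).inv ≫ r ◁ adj.unit ≫ (α_ r l r).inv ≫ adj.counit ▷ r =
      (λ_ r).inv ≫ 𝟙 (𝟙 y) ▷ r := by
  calc
    _ = 𝟙 _ ⊗≫ rightZigzag adj.unit adj.counit ⊗≫ 𝟙 _ := by bicategory
    _ = _ := by rw [adj.right_triangle]; bicategory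

theorem adjCone_mult :
    r ◁ ((α_ l r (l ≫ r)).hom ≫ l ◁ (α_ r l r).inv ≫ l ◁ (adj.counit ▷ r) ≫ l ◁ (λ_ r).hom) ≫
        (α_ r l r).inv ≫ adj.counit ▷ r =
      (α_ r (l ≫ r) (l ≫ r)).inv ≫ ((α_ r l r).inv ≫ adj.counit ▷ r) ▷ (l ≫ r) ≫
        (α_ (𝟙 y) r (l ≫ r)).hom ≫ 𝟙 y ◁ ((α_ r l r).inv ≫ adj.counit ▷ r) ≫
        (α_ (𝟙 y) (𝟙 y) r).inv ≫ (λ_ (𝟙 y)).hom ▷ r := by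
  calc
    _ = 𝟙 _ ⊗≫ ((r ≫ l) ◁ adj.counit ≫ adj.counit ▷ 𝟙 y) ▷ r ⊗≫ 𝟙 _ := by bicategory
    _ = _ := by rw [whisker_exchange]; bicategory

theorem homAdj_unit_nat {a : B} {f g : a ⟶ x} (τ : f ⟶ g) :
    τ ≫ (ρ_ g).inv ≫ g ◁ adj.unit ≫ (α_ g l r).inv =
      ((ρ_ f).inv ≫ f ◁ adj.unit ≫ (α_ f l r).inv) ≫ (τ ▷ l) ▷ r := by
  calc
    _ = (ρ_ f).inv ≫ (τ ▷ 𝟙 x ≫ g ◁ adj.unit) ≫ (α_ g l r).inv := by bicategory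
    _ = _ := by rw [← whisker_exchange]; bicategory

theorem homAdj_counit_nat {a : B} {f g : a ⟶ y} (τ : f ⟶ g) :
    (τ ▷ r) ▷ l ≫ (α_ g r l).hom ≫ g ◁ adj.counit ≫ (ρ_ g).hom =
      ((α_ f r l).hom ≫ f ◁ adj.counit ≫ (ρ_ f).hom) ≫ τ := by
  calc
    _ = (α_ f r l).hom ≫ (τ ▷ (r ≫ l) ≫ g ◁ adj.counit) ≫ (ρ_ g).hom := by bicategory
    _ = _ := by rw [← whisker_exchange]; bicategory

theorem homAdj_left {a : B} (f : a ⟶ x) :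
    ((ρ_ f).inv ≫ f ◁ adj.unit ≫ (α_ f l r).inv) ▷ l ≫
      (α_ (f ≫ l) r l).hom ≫ (f ≫ l) ◁ adj.counit ≫ (ρ_ (f ≫ l)).hom = 𝟙 (f ≫ l) := by
  calc
    _ = 𝟙 _ ⊗≫ f ◁ leftZigzag adj.unit adj.counit ⊗≫ 𝟙 _ := by bicategory
    _ = _ := by rw [adj.left_triangle]; bicategory

theorem homAdj_right {a : B} (f : a ⟶ y) :
    ((ρ_ (f ≫ r)).inv ≫ (f ≫ r) ◁ adj.unit ≫ (α_ (f ≫ r) l r).inv) ≫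
      ((α_ f r l).hom ≫ f ◁ adj.counit ≫ (ρ_ f).hom) ▷ r = 𝟙 (f ≫ r) := by
  calc
    _ = 𝟙 _ ⊗≫ f ◁ rightZigzag adj.unit adj.counit ⊗≫ 𝟙 _ := by bicategory
    _ = _ := by rw [adj.right_triangle]; bicategory
end AdjunctionLaws

section Adjunctions

variable {x y : B} {l : x ⟶ y} {r : y ⟶ x} (adj : Bicategory.Adjunction l r)

/-- The monad induced by an adjunction. -/
@[simps]
def adjMonad : BicatMonad B where
  obj := x
  endo := l ≫ r
  unit := adj.unit
  mult := (α_ l r (l ≫ r)).hom ≫ l ◁ (α_ r l r).inv ≫ l ◁ (adj.counit ▷ r) ≫ l ◁ (λ_ r).hom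
  right_unit := adjMonad_right_unit adj
  left_unit := adjMonad_left_unit adj
  assoc := adjMonad_assoc adj

/-- The Eilenberg–Moore cone for the monad of an adjunction given by the right adjoint. -/
@[simps]
def adjCone : EMCone (adjMonad adj) where
  obj := y
  hom :=
    { mor := r
      cell := (α_ r l r).inv ≫ adj.counit ▷ r
      unit_cell := adjCone_unit adj
      mult_cell := adjCone_mult adj }

/-- The comparison 1-cell of an adjunction. -/
noncomputable def comparison (E : EMObjects B) : y ⟶ (E.cone (adjMonad adj)).obj :=
  E.lift (adjCone adj)

end Adjunctions

/-- A 1-cell is an adjoint equivalence if it is a left adjoint with invertible unit and counit. -/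
def IsAdjointEquivalence {x y : B} (f : x ⟶ y) : Prop :=
  ∃ (g : y ⟶ x) (adj : Bicategory.Adjunction f g), IsIso adj.unit ∧ IsIso adj.counit

/-- An adjunction in a bicategory with Eilenberg–Moore objects is monadic if its comparison 1-cell
is an adjoint equivalence. -/
def IsMonadic (E : EMObjects B) {x y : B} {l : x ⟶ y} {r : y ⟶ x}
    (adj : Bicategory.Adjunction l r) : Prop :=
  IsAdjointEquivalence (comparison adj E)

/-- The adjunction of functors between hom-categories induced by an adjunction. -/
@[simps]
def homAdj (a : B) {x y : B} {l : x ⟶ y} {r : y ⟶ x} (adj : Bicategory.Adjunction l r) :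
    Bicategory.postcomp a l ⊣ Bicategory.postcomp a r where
  unit :=
    { app := fun f => (ρ_ f).inv ≫ f ◁ adj.unit ≫ (α_ f l r).inv
      naturality := fun _ _ τ => homAdj_unit_nat adj τ }
  counit :=
    { app := fun f => (α_ f r l).hom ≫ f ◁ adj.counit ≫ (ρ_ f).hom
      naturality := fun _ _ τ => homAdj_counit_nat adj τ }
  left_triangle_components f := homAdj_left adj f
  right_triangle_components f := homAdj_right adj f

end Monads

section CatEM

theorem comp_aux₁ {C : Type v} [Category.{w} C] {X Y Z : C} (p : X ⟶ Y) (q : Y ⟶ Z)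
    (i : Z ⟶ Z) (hi : i = 𝟙 Z) : 𝟙 X ≫ p ≫ 𝟙 Y ≫ q ≫ 𝟙 Z ≫ i = p ≫ q := by
  subst hi; simp

theorem comp_aux₂ {C : Type v} [Category.{w} C] {X Y Z : C} (p : X ⟶ Y) (q : Y ⟶ Z) :
    (𝟙 X ≫ p ≫ 𝟙 Y ≫ 𝟙 Y) ≫ q = p ≫ q := by
  simp

theorem comp_aux₃ {C : Type v} [Category.{w} C] {X Y Z : C} (p : X ⟶ Y) (q : Y ⟶ Z) :
    p ≫ 𝟙 Y ≫ q ≫ 𝟙 Z ≫ 𝟙 Z = p ≫ q := by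
  simp

variable (m : BicatMonad Cat.{w, max w v})

/-- A monad in the bicategory `Cat` as an ordinary monad on a category. -/
@[simps! coe η μ]
def catMonad : CategoryTheory.Monad m.obj where
  toFunctor := m.endo.toFunctor
  η := m.unit.toNatTrans
  μ := m.mult.toNatTrans
  left_unit X := by
    have h := congrArg (fun α => α.toNatTrans.app X) m.right_unit
    simpa using h
  right_unit X := by
    have h := congrArg (fun α => α.toNatTrans.app X) m.left_unit
    simpa using h
  assoc X := by
    have h := congrArg (fun α => α.toNatTrans.app X) m.assoc
    simpa using h.symm

/-- The Eilenberg–Moore cone in `Cat` given by the category of algebras and the forgetful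
functor. -/
@[simps]
def catCone : EMCone m where
  obj := Cat.of (catMonad m).Algebra
  hom :=
    { mor := (catMonad m).forget.toCatHom
      cell := Cat.Hom₂.ofNatTrans
        { app := fun A => A.a
          naturality := fun _ _ f => f.h }
      unit_cell := by
        apply Cat.Hom₂.ext
        apply NatTrans.ext
        funext A
        exact congrArg (fun f => 𝟙 A.A ≫ f) A.unit
      mult_cell := by
        apply Cat.Hom₂.ext
        apply NatTrans.ext
        funext A
        exact A.assoc.trans (comp_aux₁ ((catMonad m).map A.a) A.a (𝟙 A.A) rfl).symm }

/-- The functor to the category of algebras induced by a cone in `Cat`. -/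
@[simps]
def catLift {X : Cat.{w, max w v}} (q : MonadHom (idMonad X) m) : X ⥤ (catMonad m).Algebra where
  obj Z :=
    { A := q.mor.toFunctor.obj Z
      a := q.cell.toNatTrans.app Z
      unit := by
        have h := congrArg (fun γ => γ.toNatTrans.app Z) q.unit_cell
        have h' := (Category.id_comp _).symm.trans (h.trans (Category.id_comp _))
        exact h'.trans (q.mor.toFunctor.map_id Z)
      assoc := by
        have h := congrArg (fun γ => γ.toNatTrans.app Z) q.mult_cell
        exact h.trans (comp_aux₁ (m.endo.toFunctor.map (q.cell.toNatTrans.app Z))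
          (q.cell.toNatTrans.app Z) _ (q.mor.toFunctor.map_id Z)) }
  map f :=
    { f := q.mor.toFunctor.map f
      h := q.cell.toNatTrans.naturality f }
  map_id Z := Monad.Algebra.Hom.ext (q.mor.toFunctor.map_id Z)
  map_comp f g := Monad.Algebra.Hom.ext (q.mor.toFunctor.map_comp f g)

/-- The cone induced by `catLift m q` is isomorphic to `q`. -/
def catLiftIso {X : Cat.{w, max w v}} (q : MonadHom (idMonad X) m) :
    ((catCone m).homFunctor X).obj (catLift m q).toCatHom ≅ q where
  hom :=
    { cell := 𝟙 q.mor
      comm := by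
        apply Cat.Hom₂.ext
        apply NatTrans.ext
        funext Z
        exact (comp_aux₂ (q.cell.toNatTrans.app Z) (𝟙 (q.mor.toFunctor.obj Z))).trans
          ((Category.comp_id _).trans ((Category.id_comp _).symm.trans
            (congrArg (fun f => f ≫ q.cell.toNatTrans.app Z) (m.endo.toFunctor.map_id _).symm))) }
  inv :=
    { cell := 𝟙 q.mor
      comm := by
        apply Cat.Hom₂.ext
        apply NatTrans.ext
        funext Z
        exact (Category.comp_id (q.cell.toNatTrans.app Z)).trans
          (((comp_aux₃ (𝟙 _) (q.cell.toNatTrans.app Z)).trans (Category.id_comp _)).symm.trans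
            (congrArg (fun f => f ≫ 𝟙 _ ≫ q.cell.toNatTrans.app Z ≫ 𝟙 _ ≫ 𝟙 _)
              (m.endo.toFunctor.map_id _).symm)) }
  hom_inv_id := MonadHom₂.ext (Category.id_comp (𝟙 q.mor))
  inv_hom_id := MonadHom₂.ext (Category.id_comp (𝟙 q.mor))

theorem catCone_isUniversal : (catCone m).IsUniversal := by
  intro X
  have : ((catCone m).homFunctor X).Faithful := by
    refine ⟨fun {F G} α β h => ?_⟩
    apply Cat.Hom₂.ext
    apply NatTrans.ext
    funext Z
    exact Monad.Algebra.Hom.ext (congrArg (fun γ => γ.cell.toNatTrans.app Z) h)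
  have : ((catCone m).homFunctor X).Full := by
    refine ⟨fun {F G} α => ⟨Cat.Hom₂.ofNatTrans
      { app := fun Z =>
          { f := α.cell.toNatTrans.app Z
            h := ?_ }
        naturality := fun Z Z' f =>
          Monad.Algebra.Hom.ext (α.cell.toNatTrans.naturality f) }, rfl⟩⟩
    have h := congrArg (fun γ => γ.toNatTrans.app Z) α.comm
    exact ((comp_aux₂ (F.toFunctor.obj Z).a (α.cell.toNatTrans.app Z)).symm.trans (h.trans
      (comp_aux₃ (m.endo.toFunctor.map (α.cell.toNatTrans.app Z)) (G.toFunctor.obj Z).a))).symm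
  have : ((catCone m).homFunctor X).EssSurj :=
    ⟨fun q => ⟨(catLift m q).toCatHom, ⟨catLiftIso m q⟩⟩⟩
  exact { }

end CatEM

/-- The Eilenberg–Moore objects of `Cat`, given by categories of algebras. -/
def catEMObjects : EMObjects Cat.{w, max w v} where
  cone := catCone
  isUniversal := catCone_isUniversal

section Induced

open Bicategory.InducedBicategory

variable {C : Type u} [Bicategory.{w, v} C] {ι : Type*} {F : ι → C}

/-- The underlying monad of a monad in a full sub-bicategory. -/
@[simps]
def inducedForget (m : BicatMonad (Bicategory.InducedBicategory C F)) : BicatMonad C where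
  obj := F m.obj
  endo := m.endo.hom
  unit := m.unit.hom
  mult := m.mult.hom
  right_unit := congrArg Hom₂.hom m.right_unit
  left_unit := congrArg Hom₂.hom m.left_unit
  assoc := congrArg Hom₂.hom m.assoc

/-- An Eilenberg–Moore cone whose object lies in a full sub-bicategory, as a cone in there. -/
@[simps]
def inducedCone (m : BicatMonad (Bicategory.InducedBicategory C F)) (i : ι)
    (h : MonadHom (idMonad (F i)) (inducedForget m)) : EMCone m where
  obj := i
  hom :=
    { mor := mkHom h.mor
      cell := ⟨h.cell⟩
      unit_cell := hom₂_ext h.unit_cell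
      mult_cell := hom₂_ext h.mult_cell }

theorem inducedCone_isUniversal (m : BicatMonad (Bicategory.InducedBicategory C F)) (i : ι)
    (h : MonadHom (idMonad (F i)) (inducedForget m))
    (hU : EMCone.IsUniversal (EMCone.mk (F i) h)) : (inducedCone m i h).IsUniversal := by
  intro x
  let G := (EMCone.mk (F i) h).homFunctor (F x)
  have hG : G.IsEquivalence := hU (F x)
  have : ((inducedCone m i h).homFunctor x).Faithful := by
    refine ⟨fun {f g} α β hαβ => hom₂_ext ?_⟩
    apply G.map_injective
    exact MonadHom₂.ext (congrArg (fun γ => γ.cell.hom) hαβ)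
  have : ((inducedCone m i h).homFunctor x).Full := by
    refine ⟨fun {f g} α => ?_⟩
    let α' : G.obj f.hom ⟶ G.obj g.hom :=
      { cell := α.cell.hom, comm := by
          have hc := congrArg Hom₂.hom α.comm
          exact hc }
    refine ⟨⟨G.preimage α'⟩, ?_⟩
    exact MonadHom₂.ext (hom₂_ext (congrArg (fun γ => γ.cell) (G.map_preimage α')))
  have : ((inducedCone m i h).homFunctor x).EssSurj := by
    refine ⟨fun q => ?_⟩
    let q' : MonadHom (idMonad (F x)) (inducedForget m) :=
      { mor := q.mor.hom
        cell := q.cell.hom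
        unit_cell := congrArg Hom₂.hom q.unit_cell
        mult_cell := by
          have hc := congrArg Hom₂.hom q.mult_cell
          exact hc }
    let e := G.objObjPreimageIso q'
    refine ⟨mkHom (G.objPreimage q'), ⟨?_⟩⟩
    exact
      { hom := { cell := ⟨e.hom.cell⟩, comm := hom₂_ext e.hom.comm }
        inv := { cell := ⟨e.inv.cell⟩, comm := hom₂_ext e.inv.comm }
        hom_inv_id := MonadHom₂.ext (hom₂_ext (congrArg (fun γ => γ.cell) e.hom_inv_id))
        inv_hom_id := MonadHom₂.ext (hom₂_ext (congrArg (fun γ => γ.cell) e.inv_hom_id)) }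
  exact { }

/-- An adjunction in a bicategory between objects of a full sub-bicategory, as an adjunction in
there. -/
@[simps]
def inducedAdj {x y : Bicategory.InducedBicategory C F} {l : F x ⟶ F y} {r : F y ⟶ F x}
    (adj : Bicategory.Adjunction l r) :
    Bicategory.Adjunction (mkHom l : x ⟶ y) (mkHom r : y ⟶ x) where
  unit := ⟨adj.unit⟩
  counit := ⟨adj.counit⟩
  left_triangle := hom₂_ext adj.left_triangle
  right_triangle := hom₂_ext adj.right_triangle

end Induced

section Univalence

/-- A category is univalent if the canonical map from equalities to isomorphisms is bijective. -/
def IsUnivalentCategory (C : Type v) [Category.{w} C] : Prop :=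
  ∀ X Y : C, Function.Bijective (fun h : X = Y => eqToIso h)

/-- A bicategory is locally univalent if for all parallel 1-cells the canonical map from equalities
to invertible 2-cells is bijective. -/
def IsLocallyUnivalent (B : Type u) [Bicategory.{w, v} B] : Prop :=
  ∀ x y : B, IsUnivalentCategory (x ⟶ y)

theorem isUnivalentCategory_algebra {C : Type v} [Category.{w} C] (hC : IsUnivalentCategory C)
    (T : CategoryTheory.Monad C) : IsUnivalentCategory T.Algebra := by
  intro X Y
  refine ⟨fun _ _ _ => rfl, fun e => ?_⟩
  obtain ⟨A, a, ha, ha'⟩ := X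
  obtain ⟨A', a', hb, hb'⟩ := Y
  obtain ⟨h, he⟩ := (hC A A').2 (T.forget.mapIso e)
  change A = A' at h
  subst h
  have hf : e.hom.f = 𝟙 A := (congrArg Iso.hom he).symm
  have hcomm := e.hom.h
  rw [hf] at hcomm
  have haa : a = a' := by simpa using hcomm.symm
  subst haa
  exact ⟨rfl, Iso.ext (Monad.Algebra.Hom.ext hf.symm)⟩

set_option linter.checkUnivs false in
/-- The bicategory `UnivCat` of univalent categories: the full sub-bicategory of `Cat` on the
univalent categories. -/
abbrev UnivCat :=
  Bicategory.InducedBicategory Cat.{w, v}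
    (fun C : { C : Cat.{w, v} // IsUnivalentCategory C } => C.1)

/-- The Eilenberg–Moore objects of `UnivCat`, given by categories of algebras. -/
def univCatEMObjects : EMObjects UnivCat.{w, max w v} where
  cone m := inducedCone m
    ⟨(catCone (inducedForget m)).obj, isUnivalentCategory_algebra m.obj.2 _⟩
    (catCone (inducedForget m)).hom
  isUniversal m := inducedCone_isUniversal m _ _ (catCone_isUniversal (inducedForget m))

end Univalence

section Representable

variable {B : Type u} [Bicategory.{w, max w v} B] {x y : B} {l : x ⟶ y} {r : y ⟶ x}

/-- An adjunction is representably monadic in `Cat` if all the induced adjunctions on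
hom-categories are monadic adjunctions in `Cat`. -/
def IsRepMonadic (adj : Bicategory.Adjunction l r) : Prop :=
  ∀ a : B, IsMonadic catEMObjects.{w, v} (homAdj a adj).toCat

/-- The hom-category of a locally univalent bicategory, as an object of `UnivCat`. -/
def univHom (hB : IsLocallyUnivalent B) (a b : B) : UnivCat.{w, max w v} :=
  (⟨Cat.of (a ⟶ b), hB a b⟩ : { C : Cat.{w, max w v} // IsUnivalentCategory C })

/-- The adjunction in `UnivCat` between hom-categories induced by an adjunction in a locally
univalent bicategory. -/
def univHomAdj (hB : IsLocallyUnivalent B) (a : B) (adj : Bicategory.Adjunction l r) :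
    Bicategory.Adjunction
      (Bicategory.InducedBicategory.mkHom (Bicategory.postcomp a l).toCatHom :
        univHom hB a x ⟶ univHom hB a y)
      (Bicategory.InducedBicategory.mkHom (Bicategory.postcomp a r).toCatHom :
        univHom hB a y ⟶ univHom hB a x) :=
  inducedAdj (x := univHom hB a x) (y := univHom hB a y) (homAdj a adj).toCat

/-- An adjunction in a locally univalent bicategory is representably monadic if all the induced
adjunctions on hom-categories are monadic adjunctions in `UnivCat`. -/
def IsUnivRepMonadic (hB : IsLocallyUnivalent B) (adj : Bicategory.Adjunction l r) : Prop :=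
  ∀ a : B, IsMonadic univCatEMObjects.{w, v} (univHomAdj hB a adj)

end Representable

end FormalMonads

namespace FormalMonads

/-! ### Adjoint equivalences are detected on hom-categories -/

section Yoneda

open Bicategory

variable {B : Type u} [Bicategory.{w, v} B]

/-! Monadicity is a condition on hom-categories, and both sides of the theorem reduce to the same
one. By the bicategorical Yoneda principle (`isAdjointEquivalence_iff_postcomp`), a 1-cell is an
adjoint equivalence exactly when composing with it is an equivalence on every hom-category. A 1-cell
between cones over the same monad, into a universal one, is therefore an adjoint equivalence iff its
source is universal too. Hence `l ⊣ r` is monadic iff the cone carried by `r` is universal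
(`isMonadic_iff_isUniversal`), that is, iff `(adjCone adj).homFunctor a` is an equivalence for every
`a`.

For fixed `a`, a monad morphism from the identity monad on `a` to the induced monad is the same as
an algebra for the monad that `homAdj a adj` induces on `a ⟶ x`. Under this equivalence
(`coneToAlgebra`) the functor above becomes the comparison functor of `homAdj a adj`, which gives
(a) one object `a` at a time.

For (b), algebras in `UnivCat` are computed as in `Cat`, and adjoint equivalences in a full
sub-bicategory are those of the ambient one, so the two notions of representable monadicity agree.
-/

theorem IsAdjointEquivalence.isEquivalence_postcomp {x y : B} {f : x ⟶ y}
    (hf : IsAdjointEquivalence f) (a : B) : (postcomp a f).IsEquivalence := by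
  obtain ⟨g, adj, hη, hε⟩ := hf
  have h₁ : ∀ k, IsIso ((homAdj a adj).unit.app k) := fun k => by
    exact inferInstanceAs (IsIso ((ρ_ k).inv ≫ k ◁ adj.unit ≫ (α_ k f g).inv))
  have h₂ : ∀ k, IsIso ((homAdj a adj).counit.app k) := fun k => by
    exact inferInstanceAs (IsIso ((α_ k g f).hom ≫ k ◁ adj.counit ≫ (ρ_ k).hom))
  exact (homAdj a adj).toEquivalence.isEquivalence_functor

/-- No triangle identity is required of `i` and `j`: the unit `i` is kept and the counit is
corrected to satisfy them. -/
theorem IsAdjointEquivalence.of_iso {x y : B} {f : x ⟶ y} {g : y ⟶ x}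
    (i : 𝟙 x ≅ f ≫ g) (j : g ≫ f ≅ 𝟙 y) : IsAdjointEquivalence f :=
  let e := Equivalence.mkOfAdjointifyCounit i j
  ⟨g, { unit := e.unit.hom
        counit := e.counit.hom
        left_triangle := e.left_triangle_hom
        right_triangle := e.right_triangle_hom },
    inferInstanceAs (IsIso e.unit.hom), inferInstanceAs (IsIso e.counit.hom)⟩

theorem isAdjointEquivalence_iff_postcomp {x y : B} (f : x ⟶ y) :
    IsAdjointEquivalence f ↔ ∀ a : B, (postcomp a f).IsEquivalence := by
  refine ⟨fun hf a => hf.isEquivalence_postcomp a, fun h => ?_⟩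
  have hx := h x
  have hy := h y
  -- Essential surjectivity at `y` gives a one-sided inverse; full faithfulness at `x` makes it
  -- two-sided, since `𝟙 x` and `f ≫ g` become isomorphic after composing with `f`.
  let g : y ⟶ x := (postcomp y f).objPreimage (𝟙 y)
  let j : g ≫ f ≅ 𝟙 y := (postcomp y f).objObjPreimageIso (𝟙 y)
  let i : 𝟙 x ≅ f ≫ g := (postcomp x f).preimageIso
    (show 𝟙 x ≫ f ≅ (f ≫ g) ≫ f from
      λ_ f ≪≫ (ρ_ f).symm ≪≫ whiskerLeftIso f j.symm ≪≫ (α_ f g f).symm)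
  exact .of_iso i j

end Yoneda

/-! ### Monadicity as universality of the cone of the right adjoint -/

section Cones

variable {B : Type u} [Bicategory.{w, v} B]

/-- Up to coherence this is `h` whiskered by `g`; it makes the components of `homFunctorCompIso`
2-cells of monads. -/
theorem homFunctor_comp_comm {a z e b : B} (g : a ⟶ z) (f : z ⟶ e) (u : e ⟶ b) (v : z ⟶ b)
    (t : b ⟶ b) (c : u ≫ t ⟶ 𝟙 e ≫ u) (d : v ≫ t ⟶ 𝟙 z ≫ v) (i : f ≫ u ⟶ v)
    (h : ((α_ f u t).hom ≫ f ◁ c ≫ f ◁ (λ_ u).hom ≫ (λ_ (f ≫ u)).inv) ≫ 𝟙 z ◁ i =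
      i ▷ t ≫ d) :
    ((α_ (g ≫ f) u t).hom ≫ (g ≫ f) ◁ c ≫ (g ≫ f) ◁ (λ_ u).hom ≫ (λ_ ((g ≫ f) ≫ u)).inv) ≫
        𝟙 a ◁ ((α_ g f u).hom ≫ g ◁ i) =
      ((α_ g f u).hom ≫ g ◁ i) ▷ t ≫
        (α_ g v t).hom ≫ g ◁ d ≫ g ◁ (λ_ v).hom ≫ (λ_ (g ≫ v)).inv := by
  calc
    _ = 𝟙 _ ⊗≫ g ◁ (((α_ f u t).hom ≫ f ◁ c ≫ f ◁ (λ_ u).hom ≫ (λ_ (f ≫ u)).inv) ≫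
        𝟙 z ◁ i) ⊗≫ 𝟙 _ := by bicategory
    _ = _ := by rw [h]; bicategory

theorem homFunctor_comp_naturality {a z e b : B} {g g' : a ⟶ z} (τ : g ⟶ g') (f : z ⟶ e)
    (u : e ⟶ b) (v : z ⟶ b) (i : f ≫ u ⟶ v) :
    (τ ▷ f) ▷ u ≫ (α_ g' f u).hom ≫ g' ◁ i = ((α_ g f u).hom ≫ g ◁ i) ≫ τ ▷ v := by
  rw [Category.assoc, Bicategory.whisker_exchange]
  simp

/-- Isomorphisms between 1-cells of monads from invertible 2-cells. -/
@[simps]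
def monadHomIsoMk {m₁ m₂ : BicatMonad B} {f g : MonadHom m₁ m₂} (e : f.mor ≅ g.mor)
    (h : f.cell ≫ m₁.endo ◁ e.hom = e.hom ▷ m₂.endo ≫ g.cell) : f ≅ g where
  hom := { cell := e.hom, comm := h }
  inv :=
    { cell := e.inv
      comm := by
        rw [← cancel_mono (m₁.endo ◁ e.hom), Category.assoc, Category.assoc, h,
          ← Bicategory.whiskerLeft_comp, e.inv_hom_id, Bicategory.whiskerLeft_id, Category.comp_id,
          ← Bicategory.comp_whiskerRight_assoc, e.inv_hom_id, Bicategory.id_whiskerRight,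
          Category.id_comp] }
  hom_inv_id := MonadHom₂.ext e.hom_inv_id
  inv_hom_id := MonadHom₂.ext e.inv_hom_id

/-- The invertible 2-cell underlying an isomorphism between 1-cells of monads. -/
@[simps]
def monadHomIsoCell {m₁ m₂ : BicatMonad B} {f g : MonadHom m₁ m₂} (i : f ≅ g) :
    f.mor ≅ g.mor where
  hom := i.hom.cell
  inv := i.inv.cell
  hom_inv_id := congrArg MonadHom₂.cell i.hom_inv_id
  inv_hom_id := congrArg MonadHom₂.cell i.inv_hom_id

namespace EMCone

variable {m : BicatMonad B} (e q : EMCone m)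

/-- Composition with a cone factors through composition with a 1-cell of cones. -/
def homFunctorCompIso (f : q.obj ⟶ e.obj) (i : (e.homFunctor q.obj).obj f ≅ q.hom) (a : B) :
    Bicategory.postcomp a f ⋙ e.homFunctor a ≅ q.homFunctor a :=
  NatIso.ofComponents
    (fun g => monadHomIsoMk
      (α_ g f e.hom.mor ≪≫ Bicategory.whiskerLeftIso g (monadHomIsoCell i))
      (homFunctor_comp_comm g f _ _ _ _ _ _ i.hom.comm))
    (fun τ => MonadHom₂.ext (homFunctor_comp_naturality τ f _ _ _))

/-- Two-out-of-three at each object `a`, applied to the factorization `homFunctorCompIso`. -/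
theorem isAdjointEquivalence_iff_isUniversal {e q : EMCone m} (he : e.IsUniversal)
    (f : q.obj ⟶ e.obj) (i : (e.homFunctor q.obj).obj f ≅ q.hom) :
    IsAdjointEquivalence f ↔ q.IsUniversal := by
  rw [isAdjointEquivalence_iff_postcomp]
  refine forall_congr' fun a => ?_
  have := he a
  rw [← Functor.isEquivalence_iff_of_iso (homFunctorCompIso e q f i a)]
  exact ⟨fun _ => inferInstance, fun _ => Functor.isEquivalence_of_comp_right _ (e.homFunctor a)⟩

end EMCone

theorem isMonadic_iff_isUniversal (E : EMObjects B) {x y : B} {l : x ⟶ y} {r : y ⟶ x}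
    (adj : Bicategory.Adjunction l r) : IsMonadic E adj ↔ (adjCone adj).IsUniversal :=
  haveI := E.isUniversal (adjMonad adj) (adjCone adj).obj
  EMCone.isAdjointEquivalence_iff_isUniversal (q := adjCone adj) (E.isUniversal (adjMonad adj))
    (comparison adj E) (Functor.objObjPreimageIso _ (adjCone adj).hom)

/-- `comparison` is obtained by choice; this lets any explicit 1-cell inducing the same cone replace
it. -/
theorem isMonadic_iff_of_iso (E : EMObjects B) {x y : B} {l : x ⟶ y} {r : y ⟶ x}
    (adj : Bicategory.Adjunction l r) (f : y ⟶ (E.cone (adjMonad adj)).obj)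
    (i : ((E.cone (adjMonad adj)).homFunctor y).obj f ≅ (adjCone adj).hom) :
    IsMonadic E adj ↔ IsAdjointEquivalence f :=
  (isMonadic_iff_isUniversal E adj).trans
    (EMCone.isAdjointEquivalence_iff_isUniversal (q := adjCone adj) (E.isUniversal _) f i).symm

end Cones

/-! ### Monadicity in `Cat` -/

section Cat

theorem isAdjointEquivalence_cat_iff {C D : Cat.{w, v}} (F : C ⟶ D) :
    IsAdjointEquivalence F ↔ F.toFunctor.IsEquivalence := by
  constructor
  · rintro ⟨G, adj, hη, hε⟩
    exact (CategoryTheory.Equivalence.mk F.toFunctor G.toFunctor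
      (Cat.Hom.toNatIso (asIso adj.unit)) (Cat.Hom.toNatIso (asIso adj.counit))).isEquivalence_functor
  · intro h
    let e := F.toFunctor.asEquivalence
    exact .of_iso (g := e.inverse.toCatHom) (Cat.Hom.isoMk e.unitIso) (Cat.Hom.isoMk e.counitIso)

theorem isMonadic_cat_iff {C D : Cat.{w, max w v}} {l : C ⟶ D} {r : D ⟶ C}
    (adj : Bicategory.Adjunction l r) :
    IsMonadic catEMObjects.{w, v} adj ↔
      (catLift (adjMonad adj) (adjCone adj).hom).IsEquivalence :=
  (isMonadic_iff_of_iso catEMObjects adj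
    (catLift (adjMonad adj) (adjCone adj).hom).toCatHom (catLiftIso _ _)).trans
    (isAdjointEquivalence_cat_iff _)

end Cat

/-! ### Transfer from `Cat` to the full sub-bicategory `UnivCat` -/

section UnivCat

open Bicategory.InducedBicategory

variable {C : Type u} [Bicategory.{w, v} C] {ι : Type*} {F : ι → C}

/-- The invertible 2-cell underlying an invertible 2-cell of a full sub-bicategory. -/
@[simps]
def homIso {x y : Bicategory.InducedBicategory C F} {f g : x ⟶ y} (i : f ≅ g) :
    f.hom ≅ g.hom where
  hom := i.hom.hom
  inv := i.inv.hom
  hom_inv_id := congrArg Hom₂.hom i.hom_inv_id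
  inv_hom_id := congrArg Hom₂.hom i.inv_hom_id

theorem isAdjointEquivalence_mkHom_iff {x y : Bicategory.InducedBicategory C F} (f : F x ⟶ F y) :
    IsAdjointEquivalence (mkHom f : x ⟶ y) ↔ IsAdjointEquivalence f := by
  constructor
  · rintro ⟨g, adj, hη, hε⟩
    have i : (𝟙 x : x ⟶ x) ≅ mkHom f ≫ g := asIso adj.unit
    have j : g ≫ mkHom f ≅ (𝟙 y : y ⟶ y) := asIso adj.counit
    exact .of_iso (g := g.hom) (homIso i) (homIso j)
  · rintro ⟨g, adj, hη, hε⟩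
    exact .of_iso (g := mkHom g) (isoMk (asIso adj.unit)) (isoMk (asIso adj.counit))

/-- Both Eilenberg–Moore objects have the same underlying category of algebras, so the one functor
`catLift` represents the comparison on either side. -/
theorem isMonadic_univCat_iff {x y : UnivCat.{w, max w v}} {l : x.1 ⟶ y.1} {r : y.1 ⟶ x.1}
    (adj : Bicategory.Adjunction l r) :
    IsMonadic univCatEMObjects.{w, v} (inducedAdj (x := x) (y := y) adj) ↔
      IsMonadic catEMObjects.{w, v} adj := by
  let k := (catLift (adjMonad adj) (adjCone adj).hom).toCatHom
  let i := catLiftIso (adjMonad adj) (adjCone adj).hom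
  rw [isMonadic_iff_of_iso catEMObjects adj k i,
    isMonadic_iff_of_iso univCatEMObjects (inducedAdj (x := x) (y := y) adj) (mkHom k)
    (monadHomIsoMk (isoMk (monadHomIsoCell i)) (hom₂_ext i.hom.comm))]
  exact isAdjointEquivalence_mkHom_iff _

end UnivCat

/-! ### Cones with vertex `a` as algebras on hom-categories -/

section Hom

variable {B : Type u} [Bicategory.{w, max w v} B] {x y : B} {l : x ⟶ y} {r : y ⟶ x}
  (adj : Bicategory.Adjunction l r) (a : B)

open Bicategory

/-- This and the next two lemmas match the laws for a cell `c` with the algebra laws for `(α_ f l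
r).hom ≫ c ≫ (λ_ f).hom`. Since associators and unitors are invertible, each law can be compared
after composing with them. -/
theorem coneAlgebra_unit_iff {B : Type u} [Bicategory.{w, v} B] {a x y : B} {l : x ⟶ y}
    {r : y ⟶ x}
    (η : 𝟙 x ⟶ l ≫ r) (f : a ⟶ x)
    (c : f ≫ l ≫ r ⟶ 𝟙 a ≫ f) :
    (ρ_ f).inv ≫ f ◁ η ≫ c = (λ_ f).inv ≫ 𝟙 (𝟙 a) ▷ f ↔
      ((ρ_ f).inv ≫ f ◁ η ≫ (α_ f l r).inv) ≫ (α_ f l r).hom ≫ c ≫ (λ_ f).hom = 𝟙 f := by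
  rw [← cancel_mono (λ_ f).hom]
  simp

theorem coneAlgebra_comm_iff {B : Type u} [Bicategory.{w, v} B] {a x y : B} {l : x ⟶ y}
    {r : y ⟶ x}
    {f g : a ⟶ x} (c : f ≫ l ≫ r ⟶ 𝟙 a ≫ f) (d : g ≫ l ≫ r ⟶ 𝟙 a ≫ g) (τ : f ⟶ g) :
    c ≫ 𝟙 a ◁ τ = τ ▷ (l ≫ r) ≫ d ↔
      (τ ▷ l) ▷ r ≫ (α_ g l r).hom ≫ d ≫ (λ_ g).hom =
        ((α_ f l r).hom ≫ c ≫ (λ_ f).hom) ≫ τ := by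
  rw [← cancel_mono (λ_ g).hom, ← cancel_epi (α_ f l r).hom]
  simp [eq_comm]

theorem coneAlgebra_mult_iff {B : Type u} [Bicategory.{w, v} B] {a x y : B} {l : x ⟶ y}
    {r : y ⟶ x}
    (d : r ≫ l ⟶ 𝟙 y) (f : a ⟶ x)
    (c : f ≫ l ≫ r ⟶ 𝟙 a ≫ f) :
    f ◁ ((α_ l r (l ≫ r)).hom ≫ l ◁ (α_ r l r).inv ≫ l ◁ (d ▷ r) ≫ l ◁ (λ_ r).hom) ≫ c =
      (α_ f (l ≫ r) (l ≫ r)).inv ≫ c ▷ (l ≫ r) ≫ (α_ (𝟙 a) f (l ≫ r)).hom ≫ 𝟙 a ◁ c ≫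
        (α_ (𝟙 a) (𝟙 a) f).inv ≫ (λ_ (𝟙 a)).hom ▷ f ↔
    ((α_ (f ≫ l) r l).hom ≫ (f ≫ l) ◁ d ≫ (ρ_ (f ≫ l)).hom) ▷ r ≫
        (α_ f l r).hom ≫ c ≫ (λ_ f).hom =
      (((α_ f l r).hom ≫ c ≫ (λ_ f).hom) ▷ l) ▷ r ≫ (α_ f l r).hom ≫ c ≫ (λ_ f).hom := by
  rw [← cancel_mono (λ_ f).hom,
    ← cancel_epi ((α_ ((f ≫ l) ≫ r) l r).hom ≫ (α_ f l r).hom ▷ (l ≫ r) ≫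
      (α_ f (l ≫ r) (l ≫ r)).hom)]
  refine Eq.congr ?_ ?_ <;> bicategory

theorem id_comp_id_comp_comp_id {C : Type v} [Category.{w} C] {X Y : C} (p : X ⟶ Y) :
    𝟙 X ≫ 𝟙 X ≫ p ≫ 𝟙 Y = p := by
  simp

/-- The associators and unitor of `Cat` in the multiplication of `adjMonad` have identity
components, leaving the whiskered counit. -/
theorem homAdj_mult_app (f : a ⟶ x) :
    (catMonad (adjMonad (homAdj a adj).toCat)).μ.app f =
      ((α_ (f ≫ l) r l).hom ≫ (f ≫ l) ◁ adj.counit ≫ (ρ_ (f ≫ l)).hom) ▷ r :=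
  id_comp_id_comp_comp_id
    (((α_ (f ≫ l) r l).hom ≫ (f ≫ l) ◁ adj.counit ≫ (ρ_ (f ≫ l)).hom) ▷ r)

/-- A 1-cell of monads from the identity monad on `a` to the monad of an adjunction, as an algebra
for the monad of the induced adjunction on hom-categories. -/
def coneToAlgebra : MonadHom (idMonad a) (adjMonad adj) ⥤
    (catMonad (adjMonad (homAdj a adj).toCat)).Algebra where
  obj q :=
    { A := q.mor
      a := (α_ q.mor l r).hom ≫ q.cell ≫ (λ_ q.mor).hom
      unit := (coneAlgebra_unit_iff adj.unit q.mor q.cell).1 q.unit_cell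
      assoc := (congrArg (fun k => k ≫ _) (homAdj_mult_app adj a q.mor)).trans
        ((coneAlgebra_mult_iff adj.counit q.mor q.cell).1 q.mult_cell) }
  map {p q} τ :=
    { f := τ.cell
      h := (coneAlgebra_comm_iff p.cell q.cell τ.cell).1 τ.comm }
  map_id _ := rfl
  map_comp _ _ := rfl

theorem coneToAlgebra_isEquivalence : (coneToAlgebra adj a).IsEquivalence := by
  have : (coneToAlgebra adj a).Faithful :=
    ⟨fun h => MonadHom₂.ext (congrArg Monad.Algebra.Hom.f h)⟩
  have : (coneToAlgebra adj a).Full :=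
    ⟨fun {p q} τ => ⟨{ cell := τ.f, comm := (coneAlgebra_comm_iff p.cell q.cell τ.f).2 τ.h }, rfl⟩⟩
  have : (coneToAlgebra adj a).EssSurj := by
    refine ⟨fun Q => ?_⟩
    let f : a ⟶ x := Q.A
    let b : (f ≫ l) ≫ r ⟶ f := Q.a
    -- Inverts the passage from cells to structure maps, so `q` has exactly `b` as its structure map
    -- by `hc`.
    let c : f ≫ l ≫ r ⟶ 𝟙 a ≫ f := (α_ f l r).inv ≫ b ≫ (λ_ f).inv
    have hc : (α_ f l r).hom ≫ c ≫ (λ_ f).hom = b := by simp [c]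
    let q : MonadHom (idMonad a) (adjMonad adj) :=
      { mor := f
        cell := c
        unit_cell := (coneAlgebra_unit_iff adj.unit f c).2 (by rw [hc]; exact Q.unit)
        mult_cell := (coneAlgebra_mult_iff adj.counit f c).2 (by
          rw [hc]
          exact (congrArg (fun k => k ≫ b) (homAdj_mult_app adj a f)).symm.trans Q.assoc) }
    refine ⟨q, ⟨Monad.Algebra.isoMk (Iso.refl _) ?_⟩⟩
    exact (congrArg (fun k => k ≫ b) ((postcomp a l ⋙ postcomp a r).map_id f)).trans
      ((Category.id_comp b).trans (hc.symm.trans (Category.comp_id _).symm))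
  exact { }

/-- The algebra structure on `f ≫ r` coming from the cone is the one the comparison functor uses:
the counit component at `f`, whiskered by `r`. -/
theorem adjCone_comp_structure {B : Type u} [Bicategory.{w, v} B] {a x y : B} {l : x ⟶ y}
    {r : y ⟶ x} (d : r ≫ l ⟶ 𝟙 y) (f : a ⟶ y) :
    (α_ (f ≫ r) l r).hom ≫ ((α_ f r (l ≫ r)).hom ≫ f ◁ ((α_ r l r).inv ≫ d ▷ r) ≫
      f ◁ (λ_ r).hom ≫ (λ_ (f ≫ r)).inv) ≫ (λ_ (f ≫ r)).hom =
      ((α_ f r l).hom ≫ f ◁ d ≫ (ρ_ f).hom) ▷ r := by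
  bicategory

/-- The comparison functor of the induced adjunction on hom-categories is composition with the
cone of the adjunction. -/
def homFunctorCompConeToAlgebra : (adjCone adj).homFunctor a ⋙ coneToAlgebra adj a ≅
    catLift (adjMonad (homAdj a adj).toCat) (adjCone (homAdj a adj).toCat).hom :=
  NatIso.ofComponents (fun f => Monad.Algebra.isoMk (Iso.refl (f ≫ r)) (by
    have h : (catLift (adjMonad (homAdj a adj).toCat) (adjCone (homAdj a adj).toCat).hom
        |>.obj f).a = ((α_ f r l).hom ≫ f ◁ adj.counit ≫ (ρ_ f).hom) ▷ r :=
      Category.id_comp (((α_ f r l).hom ≫ f ◁ adj.counit ≫ (ρ_ f).hom) ▷ r)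
    rw [h]
    exact (congrArg (fun k => k ≫ _) ((postcomp a l ⋙ postcomp a r).map_id (f ≫ r))).trans
      ((Category.id_comp _).trans ((adjCone_comp_structure adj.counit f).symm.trans
        (Category.comp_id _).symm)))) (fun τ => Monad.Algebra.Hom.ext
      ((Category.comp_id (τ ▷ r)).trans (Category.id_comp (τ ▷ r)).symm))

/-- Two-out-of-three again, now with the equivalence `coneToAlgebra` as second factor. -/
theorem isMonadic_homAdj_iff : IsMonadic catEMObjects.{w, v} (homAdj a adj).toCat ↔
    ((adjCone adj).homFunctor a).IsEquivalence := by
  have := coneToAlgebra_isEquivalence adj a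
  refine (isMonadic_cat_iff _).trans
    ((Functor.isEquivalence_iff_of_iso (homFunctorCompConeToAlgebra adj a)).symm.trans ?_)
  exact ⟨fun _ => Functor.isEquivalence_of_comp_right _ (coneToAlgebra adj a),
    fun _ => inferInstance⟩

theorem isMonadic_iff_isRepMonadic (E : EMObjects B) :
    IsMonadic E adj ↔ IsRepMonadic.{w, v} adj :=
  (isMonadic_iff_isUniversal E adj).trans
    (forall_congr' fun a => (isMonadic_homAdj_iff adj a).symm)

theorem isUnivRepMonadic_iff_isRepMonadic (hB : IsLocallyUnivalent B) :
    IsUnivRepMonadic.{w, v} hB adj ↔ IsRepMonadic.{w, v} adj :=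
  forall_congr' fun a => isMonadic_univCat_iff (x := univHom hB a x) (y := univHom hB a y)
    (homAdj a adj).toCat

end Hom

end FormalMonads

theorem mainTheorem1 {B : Type u} [Bicategory.{w, max w v} B] (E : FormalMonads.EMObjects B)
    {x y : B} {l : x ⟶ y} {r : y ⟶ x} (adj : Bicategory.Adjunction l r) :
    (FormalMonads.IsMonadic E adj ↔ FormalMonads.IsRepMonadic.{w, v} adj) ∧
    ∀ hB : FormalMonads.IsLocallyUnivalent B,
      (FormalMonads.IsMonadic E adj ↔ FormalMonads.IsUnivRepMonadic.{w, v} hB adj) :=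
  have h := FormalMonads.isMonadic_iff_isRepMonadic adj E
  ⟨h, fun hB => h.trans (FormalMonads.isUnivRepMonadic_iff_isRepMonadic adj hB).symm⟩
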